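/- All graphs are finite, undirected and loopless, and may have parallel edges. The degree of a vertex is the number of distinct vertices adjacent to it, and the minimum degree of a graph is the minimum over its vertices. A graph $H$ is a minor of a graph $G$ if a graph isomorphic to $H$ can be obtained from $G$ by vertex removals, edge removals and edge contractions (loops that arise from a contraction being discarded). For $r\in\mathbb N$ let $\theta_r$ be the graph with two vertices and $r$ parallel edges between them. The $\theta_r$-girth of $G$ is the minimum number of edges of a subgraph of $G$ that contains $\theta_r$ as a minor, and it is $\infty$ if $G$ has no $\theta_r$ minor. **Theorem.** There is a constant $c>0$ such that for all integers $r\ge 2$, $d\ge 3r$ and $z\ge 2r$, every graph of minimum degree $d$ and $\theta_r$-girth at least $z$ contains as a minor a complete graph on $k$ vertices, for some integer $k$ with $$k\;\ge\;\frac{\left(\frac dr\right)^{c\,\frac zr}}{\sqrt{\frac zr\cdot\log_2 d}}.$$ -/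

import Mathlib

open scoped Graph

namespace ThetaGirth

universe u v u' v'

/-- The degree of `x` in a multigraph: the number of vertices adjacent to `x`
(parallel edges are not counted separately). -/
noncomputable def degree {α : Type u} {β : Type v} (G : Graph α β) (x : α) : ℕ :=
  {y | G.Adj x y}.ncard

/-- The minimum degree over all vertices (with value `0` for the graph without vertices). -/
noncomputable def minDegree {α : Type u} {β : Type v} (G : Graph α β) : ℕ :=
  sInf (degree G '' V(G))

open Classical in
/-- Contraction of the edges between the vertices `x` and `y`: these edges are removed and `y` is
identified with `x`. Every other edge keeps its identity, so parallel edges can arise, but no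
new loops do. -/
noncomputable def contract {α : Type u} {β : Type v} (G : Graph α β) (x y : α) : Graph α β :=
  (G.deleteEdges {e | G.IsLink e x y}).map (fun w => if w = y then x else w)

/-- `Step G G'`: the multigraph `G'` arises from `G` by one vertex removal, one edge removal or the
contraction of one edge. -/
inductive Step {α : Type u} {β : Type v} (G : Graph α β) : Graph α β → Prop
  | deleteVertex (x : α) (hx : x ∈ V(G)) : Step G (G.deleteVerts {x})
  | deleteEdge (e : β) (he : e ∈ E(G)) : Step G (G.deleteEdges {e})
  | contractEdge (e : β) (x y : α) (he : G.IsLink e x y) (hxy : x ≠ y) : Step G (contract G x y)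

/-- Isomorphism of multigraphs: bijections between the vertices and between the edges that
respect incidence. -/
def Isomorphic {α : Type u} {β : Type v} {α' : Type u'} {β' : Type v'}
    (G : Graph α β) (H : Graph α' β') : Prop :=
  ∃ (f : V(G) ≃ V(H)) (g : E(G) ≃ E(H)), ∀ (e : E(G)) (x y : V(G)),
    G.IsLink e x y ↔ H.IsLink (g e) (f x) (f y)

/-- `H` is a minor of `G`: up to isomorphism, `H` is obtained from `G` by a sequence of vertex
removals, edge removals and edge contractions. -/
def IsMinor {α : Type u} {β : Type v} {α' : Type u'} {β' : Type v'}
    (H : Graph α' β') (G : Graph α β) : Prop :=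
  ∃ G' : Graph α β, Relation.ReflTransGen Step G G' ∧ Isomorphic G' H

/-- An `H`-model in `G` is a subgraph of `G` that contains `H` as a minor. -/
def IsModel {α : Type u} {β : Type v} {α' : Type u'} {β' : Type v'}
    (H : Graph α' β') (G M : Graph α β) : Prop :=
  M ≤ G ∧ IsMinor H M

/-- The `H`-girth of `G`: the minimum number of edges of an `H`-model in `G`, and `⊤` if there is
no such model. -/
noncomputable def girth {α : Type u} {β : Type v} {α' : Type u'} {β' : Type v'}
    (H : Graph α' β') (G : Graph α β) : ℕ∞ :=
  sInf {n | ∃ M : Graph α β, IsModel H G M ∧ n = E(M).encard}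

/-- The multigraph `θ_r` with two vertices and `r` parallel edges between them. -/
def theta (r : ℕ) : Graph (Fin 2) (Fin r) :=
  Graph.banana 0 1 Set.univ

/-- The complete simple graph on `k` vertices, as a multigraph. -/
def clique (k : ℕ) : Graph (Fin k) (Sym2 (Fin k)) :=
  Graph.ofSimpleGraph (⊤ : SimpleGraph (Fin k))

end ThetaGirth

/-!
A lower bound on the `θ_r`-girth forces sparseness: `r` edges between two disjoint connected sets of
small radius would span a `θ_r`-model with few edges. Take a maximal set of vertices at pairwise
distance more than `2R`, with `R` about `z / 4r`, and split the graph into the breadth-first trees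
rooted at these vertices. By sparseness a vertex has fewer than `r` neighbours in its own tree which
are not deeper than itself, and fewer than `r` edges join two given trees. Hence the levels of every
tree grow by the factor `d / r - 1` up to level `R`, and contracting the trees yields a simple graph
of minimum degree at least `(d / r - 2) (d / r - 1) ^ R`.

A simple graph of minimum degree `24 k²` has a `K_k` minor. Put `m = 12 k²`. In a minor on `n`
vertices with at least `m n` edges and `n` minimal, deleting or contracting anything costs more
than `m` edges, so every edge lies in at least `m` triangles, and some vertex has a neighbourhood of
between `m` and `2m` vertices, each adjacent to at least half of the others. Among any three of
these vertices two have a sixth of the neighbourhood in common, so the Ramsey bound for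
triangle-free graphs supplies `k` vertices which pairwise have enough common neighbours to be
connected disjointly.
-/

namespace ThetaGirth

open Relation Function

section Connectivity

variable {V W : Type*} {r : V → V → Prop} {S : Set V}

/-- Any two elements of `S` are joined by a chain of `r`-related elements of `S`. With `r` the
adjacency relation this says that `S` induces a connected subgraph; it is stated for relations
because it is used both for multigraphs and for simple graphs. The empty set is allowed. -/
def ConnectedOn (r : V → V → Prop) (S : Set V) : Prop :=
  ∀ u ∈ S, ∀ v ∈ S, ReflTransGen (fun a b => r a b ∧ a ∈ S ∧ b ∈ S) u v

lemma connectedOn_singleton (r : V → V → Prop) (v : V) : ConnectedOn r {v} := by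
  rintro _ rfl _ rfl
  exact .refl

lemma connectedOn_of_reflTransGen [Std.Symm r] {c : V}
    (h : ∀ v ∈ S, ReflTransGen (fun a b => r a b ∧ a ∈ S ∧ b ∈ S) v c) : ConnectedOn r S := by
  have : Std.Symm fun a b => r a b ∧ a ∈ S ∧ b ∈ S :=
    ⟨fun _ _ ⟨hab, ha, hb⟩ => ⟨symm_of r hab, hb, ha⟩⟩
  exact fun u hu v hv => (h u hu).trans (symm_of _ (h v hv))

lemma ConnectedOn.image {r' : W → W → Prop} {f : V → W} (hS : ConnectedOn r S)
    (hf : ∀ a b, r a b → f a = f b ∨ r' (f a) (f b)) : ConnectedOn r' (f '' S) := by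
  rintro _ ⟨u, hu, rfl⟩ _ ⟨v, hv, rfl⟩
  refine ReflTransGen.lift' f (fun a b ⟨hab, ha, hb⟩ => ?_) u v (hS u hu v hv)
  obtain hab | hab := hf a b hab
  · rw [Function.onFun, hab]
  · exact .single ⟨hab, Set.mem_image_of_mem f ha, Set.mem_image_of_mem f hb⟩

lemma ConnectedOn.biUnion {s : W → W → Prop} {T : Set W} {B : W → Set V} (hT : ConnectedOn s T)
    (hB : ∀ i, ConnectedOn r (B i)) (hs : ∀ i j, s i j → ∃ u ∈ B i, ∃ v ∈ B j, r u v) :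
    ConnectedOn r (⋃ i ∈ T, B i) := by
  have within : ∀ i ∈ T, ∀ u ∈ B i, ∀ v ∈ B i, ReflTransGen
      (fun a b => r a b ∧ (a ∈ ⋃ i ∈ T, B i) ∧ b ∈ ⋃ i ∈ T, B i) u v := fun i hi u hu v hv =>
    ReflTransGen.mono (fun a b ⟨hab, ha, hb⟩ =>
      ⟨hab, Set.mem_biUnion hi ha, Set.mem_biUnion hi hb⟩) u v (hB i u hu v hv)
  intro u hu v hv
  obtain ⟨i, hi, hui⟩ := Set.mem_iUnion₂.1 hu
  obtain ⟨j, hj, hvj⟩ := Set.mem_iUnion₂.1 hv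
  have chain := hT i hi j hj
  induction chain generalizing v with
  | refl => exact within i hi u hui v hvj
  | @tail k j _ hkj ih =>
    obtain ⟨a, ha, b, hb, hab⟩ := hs k j hkj.1
    have ha' := Set.mem_biUnion hkj.2.1 ha
    exact ((ih a ha' hkj.2.1 ha).tail ⟨hab, ha', Set.mem_biUnion hj hb⟩).trans
      (within j hj b hb v hvj)

lemma ConnectedOn.exists_ne (hS : ConnectedOn r S) (hnt : S.Nontrivial) :
    ∃ a ∈ S, ∃ b ∈ S, a ≠ b ∧ r a b := by
  obtain ⟨u, hu, v, hv, huv⟩ := hnt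
  by_contra! h
  have eq_of_chain : ∀ w, ReflTransGen (fun a b => r a b ∧ a ∈ S ∧ b ∈ S) u w → u = w := by
    intro w hw
    induction hw with
    | refl => rfl
    | tail _ hbc ih =>
      exact ih.trans (by_contra fun hne => h _ hbc.2.1 _ hbc.2.2 hne hbc.1)
  exact huv (eq_of_chain v (hS u hu v hv))

end Connectivity

section MultigraphMinors

variable {α β α' β' : Type*} {G : Graph α β} {H : Graph α' β'} {B : V(H) → Set α} {ε : E(H) → β}

lemma reflTransGen_step_deleteVerts (G : Graph α β) {S : Set α} (hS : S.Finite) (hSV : S ⊆ V(G)) :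
    ReflTransGen Step G (G.deleteVerts S) := by
  induction S, hS using Set.Finite.induction_on with
  | empty => rw [Graph.deleteVerts_empty]
  | @insert a S ha _ ih =>
    have delete_last : G.deleteVerts (insert a S) = (G.deleteVerts S).deleteVerts {a} := by
      refine Graph.ext ?_ fun e x y => ?_
      · simp only [Graph.vertexSet_deleteVerts, Set.sdiff_sdiff, Set.union_singleton]
      · simp only [Graph.deleteVerts_isLink, Set.mem_insert_iff, Set.mem_singleton_iff]
        tauto
    rw [delete_last]
    exact (ih ((Set.subset_insert _ _).trans hSV)).tail
      (.deleteVertex a (by simpa [ha] using hSV (Set.mem_insert _ _)))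

lemma reflTransGen_step_deleteEdges (G : Graph α β) {F : Set β} (hF : F.Finite) (hFE : F ⊆ E(G)) :
    ReflTransGen Step G (G.deleteEdges F) := by
  induction F, hF using Set.Finite.induction_on with
  | empty => rw [Graph.deleteEdges_empty]
  | @insert a F ha _ ih =>
    have delete_last : G.deleteEdges (insert a F) = (G.deleteEdges F).deleteEdges {a} := by
      rw [Graph.deleteEdges_deleteEdges, Set.union_singleton]
    rw [delete_last]
    exact (ih ((Set.subset_insert _ _).trans hFE)).tail
      (.deleteEdge a (by simpa [ha] using hFE (Set.mem_insert _ _)))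

lemma isomorphic_of_equiv (φ : V(H) ≃ V(G)) (ε : E(H) ≃ E(G))
    (hlink : ∀ (e : E(H)) (i j : V(H)), H.IsLink e i j → G.IsLink (ε e) (φ i) (φ j)) :
    Isomorphic G H := by
  suffices isLink_iff : ∀ e i j, G.IsLink (ε e) (φ i) (φ j) ↔ H.IsLink e i j from
    ⟨φ.symm, ε.symm, fun e x y => by simp [← isLink_iff]⟩
  refine fun e i j => ⟨fun h => ?_, hlink e i j⟩
  obtain ⟨i', j', hij'⟩ := Graph.exists_isLink_of_mem_edgeSet e.2
  lift i' to V(H) using hij'.left_mem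
  lift j' to V(H) using hij'.right_mem
  obtain ⟨hi, hj⟩ | ⟨hi, hj⟩ := h.eq_and_eq_or_eq_and_eq (hlink e i' j' hij')
  · rwa [φ.injective (Subtype.ext hi), φ.injective (Subtype.ext hj)]
  · rw [φ.injective (Subtype.ext hi), φ.injective (Subtype.ext hj)]
    exact hij'.symm

lemma isMinor_of_injective (hV : V(G).Finite) (hE : E(G).Finite) {φ : V(H) → α}
    (hφ : φ.Injective) (hφV : ∀ i, φ i ∈ V(G)) (hε : ε.Injective)
    (hlink : ∀ (e : E(H)) (i j : V(H)), H.IsLink e i j → G.IsLink (ε e) (φ i) (φ j)) :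
    IsMinor H G := by
  set G₁ := G.deleteVerts (V(G) \ Set.range φ) with hG₁
  set G₂ := G₁.deleteEdges (E(G₁) \ Set.range ε) with hG₂
  have isLink_G₂ : ∀ (e : E(H)) (i j : V(H)), H.IsLink e i j → G₂.IsLink (ε e) (φ i) (φ j) :=
    fun e i j h => by simp [hG₂, hG₁, hlink e i j h]
  have vertexSet_G₂ : V(G₂) = Set.range φ := by
    rw [hG₂, Graph.vertexSet_deleteEdges, hG₁, Graph.vertexSet_deleteVerts, sdiff_sdiff_right_self]
    exact Set.inter_eq_right.2 (Set.range_subset_iff.2 hφV)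
  have edgeSet_G₂ : E(G₂) = Set.range ε := by
    refine Set.Subset.antisymm (fun e he => ?_) (Set.range_subset_iff.2 fun e => ?_)
    · simp only [hG₂, Graph.edgeSet_deleteEdges, sdiff_sdiff_right_self] at he
      exact he.2
    · obtain ⟨i, j, h⟩ := Graph.exists_isLink_of_mem_edgeSet e.2
      exact (isLink_G₂ e ⟨i, h.left_mem⟩ ⟨j, h.right_mem⟩ h).edge_mem
  refine ⟨G₂, (reflTransGen_step_deleteVerts G (hV.subset Set.sdiff_subset)
    Set.sdiff_subset).trans (reflTransGen_step_deleteEdges G₁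
    ((hE.subset Graph.deleteVerts_le.edgeSet_mono).subset Set.sdiff_subset) Set.sdiff_subset), ?_⟩
  exact isomorphic_of_equiv ((Equiv.ofInjective φ hφ).trans (Equiv.setCongr vertexSet_G₂.symm))
    ((Equiv.ofInjective ε hε).trans (Equiv.setCongr edgeSet_G₂.symm)) isLink_G₂

/-- A model of the multigraph `H` as a minor of `G`: each vertex `i` of `H` is represented by the
connected branch set `B i`, and each edge `e` of `H` by the edge `ε e` of `G`. -/
structure IsMinorModel (H : Graph α' β') (G : Graph α β) (B : V(H) → Set α) (ε : E(H) → β) :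
    Prop where
  nonempty : ∀ i, (B i).Nonempty
  subset : ∀ i, B i ⊆ V(G)
  disjoint : Pairwise (Disjoint on B)
  connected : ∀ i, ConnectedOn G.Adj (B i)
  injective : ε.Injective
  isLink : ∀ (e : E(H)) (i j : V(H)), H.IsLink e i j → ∃ u ∈ B i, ∃ v ∈ B j, G.IsLink (ε e) u v

lemma eq_of_mem_of_mem {ι : Type*} {B : ι → Set α} (hB : Pairwise (Disjoint on B)) {i j : ι} {x : α}
    (hi : x ∈ B i) (hj : x ∈ B j) : i = j :=
  hB.eq (Set.not_disjoint_iff.2 ⟨x, hi, hj⟩)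

lemma IsMinorModel.isMinor_of_subsingleton (h : IsMinorModel H G B ε) (hV : V(G).Finite)
    (hE : E(G).Finite) (hB : ∀ i, (B i).Subsingleton) : IsMinor H G := by
  choose φ hφ using h.nonempty
  refine isMinor_of_injective hV hE (φ := φ) (fun i j hij => ?_) (fun i => h.subset i (hφ i))
    h.injective fun e i j hij => ?_
  · exact eq_of_mem_of_mem h.disjoint (hφ i) (hij ▸ hφ j)
  · obtain ⟨u, hu, v, hv, huv⟩ := h.isLink e i j hij
    rwa [hB i (hφ i) hu, hB j (hφ j) hv]

lemma IsMinorModel.contract [H.Loopless] (h : IsMinorModel H G B ε) {x y : α} {k : V(H)}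
    (hx : x ∈ B k) (hy : y ∈ B k) : ∃ B', IsMinorModel H (ThetaGirth.contract G x y) B' ε := by
  classical
  let f : α → α := fun w => if w = y then x else w
  have image_subset : ∀ i, f '' B i ⊆ B i := by
    rintro i _ ⟨w, hw, rfl⟩
    by_cases hwy : w = y
    · simpa [f, hwy, eq_of_mem_of_mem h.disjoint (hwy ▸ hw) hy] using hx
    · simpa [f, hwy] using hw
  have isLink_contract : ∀ e u v, G.IsLink e u v →
      G.IsLink e x y ∧ f u = f v ∨ (ThetaGirth.contract G x y).IsLink e (f u) (f v) := by
    intro e u v huv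
    by_cases hxy : G.IsLink e x y
    · obtain ⟨rfl, rfl⟩ | ⟨rfl, rfl⟩ := huv.eq_and_eq_or_eq_and_eq hxy <;> simp [f, hxy]
    · exact .inr (Graph.IsLink.map f (by simp [huv, hxy]))
  refine ⟨fun i => f '' B i, fun i => (h.nonempty i).image f, fun i => ?_,
    fun i j hij => (h.disjoint hij).mono (image_subset i) (image_subset j),
    fun i => (h.connected i).image fun a b ⟨e, he⟩ =>
      (isLink_contract e a b he).imp And.right fun h' => ⟨e, h'⟩,
    h.injective, fun e i j hij => ?_⟩
  · simpa [ThetaGirth.contract] using Set.image_mono (f := f) (h.subset i)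
  · obtain ⟨u, hu, v, hv, huv⟩ := h.isLink e i j hij
    refine ⟨f u, Set.mem_image_of_mem f hu, f v, Set.mem_image_of_mem f hv,
      (isLink_contract _ u v huv).resolve_left fun ⟨hxy, _⟩ => hij.ne (congrArg Subtype.val ?_)⟩
    have mem_branch : ∀ {w}, w = x ∨ w = y → w ∈ B k := by rintro w (rfl | rfl) <;> assumption
    have huvk : u ∈ B k ∧ v ∈ B k := by
      obtain ⟨hu, hv⟩ | ⟨hu, hv⟩ := huv.eq_and_eq_or_eq_and_eq hxy <;>
        exact ⟨mem_branch (by simp [hu]), mem_branch (by simp [hv])⟩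
    exact (eq_of_mem_of_mem h.disjoint hu huvk.1).trans (eq_of_mem_of_mem h.disjoint huvk.2 hv)

lemma vertexSet_contract_ssubset {x y : α} (hx : x ∈ V(G)) (hy : y ∈ V(G)) (hxy : x ≠ y) :
    V(contract G x y) ⊂ V(G) := by
  refine (Set.ssubset_iff_of_subset ?_).2 ⟨y, hy, ?_⟩
  · rintro _ ⟨w, hw, rfl⟩
    dsimp only
    split_ifs
    exacts [hx, hw]
  · rintro ⟨w, -, hw⟩
    dsimp only at hw
    split_ifs at hw with hwy
    exacts [hxy hw, hwy hw]

theorem IsMinorModel.isMinor [H.Loopless] (h : IsMinorModel H G B ε) (hV : V(G).Finite)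
    (hE : E(G).Finite) : IsMinor H G := by
  induction hn : V(G).ncard using Nat.strong_induction_on generalizing G B with
  | _ n ih =>
  by_cases hB : ∀ i, (B i).Subsingleton
  · exact h.isMinor_of_subsingleton hV hE hB
  push Not at hB
  obtain ⟨k, hBk⟩ := hB
  obtain ⟨x, hx, y, hy, hxy, e, he⟩ := (h.connected k).exists_ne hBk
  obtain ⟨B', hB'⟩ := h.contract hx hy
  have smaller := vertexSet_contract_ssubset he.left_mem he.right_mem hxy
  have edgeSet_subset : E(ThetaGirth.contract G x y) ⊆ E(G) := by
    simp [ThetaGirth.contract]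
  obtain ⟨G', hG', hiso⟩ := ih _ (hn ▸ Set.ncard_lt_ncard smaller hV) hB'
    (hV.subset smaller.subset) (hE.subset edgeSet_subset) rfl
  exact ⟨G', hG'.head (.contractEdge e x y he hxy), hiso⟩

end MultigraphMinors

section SimpleMinors

variable {U V W : Type*} {G : SimpleGraph V} {H : SimpleGraph U} {K : SimpleGraph W}

/-- The simple graph `H` is a minor of the simple graph `G`, witnessed by the branch sets `B w`. -/
def HasModel (H : SimpleGraph W) (G : SimpleGraph V) : Prop :=
  ∃ B : W → Set V, (∀ w, (B w).Nonempty) ∧ Pairwise (Disjoint on B) ∧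
    (∀ w, ConnectedOn G.Adj (B w)) ∧ ∀ w w', H.Adj w w' → ∃ u ∈ B w, ∃ v ∈ B w', G.Adj u v

lemma HasModel.trans (hHK : HasModel H K) (hKG : HasModel K G) : HasModel H G := by
  obtain ⟨B, hB, hBdisj, hBconn, hBadj⟩ := hHK
  obtain ⟨C, hC, hCdisj, hCconn, hCadj⟩ := hKG
  refine ⟨fun u => ⋃ w ∈ B u, C w, fun u => ?_, fun u u' huu' => ?_,
    fun u => (hBconn u).biUnion hCconn hCadj, fun u u' huu' => ?_⟩
  · obtain ⟨w, hw⟩ := hB u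
    exact (hC w).mono (Set.subset_biUnion_of_mem hw)
  · simp only [Function.onFun, Set.disjoint_iUnion_left, Set.disjoint_iUnion_right]
    exact fun w hw w' hw' => hCdisj ((hBdisj huu').ne_of_mem hw' hw)
  · obtain ⟨w, hw, w', hw', hww'⟩ := hBadj u u' huu'
    obtain ⟨x, hx, y, hy, hxy⟩ := hCadj w w' hww'
    exact ⟨x, Set.mem_biUnion hw hx, y, Set.mem_biUnion hw' hy, hxy⟩

lemma HasModel.of_isContained (h : K.IsContained G) : HasModel K G := by
  obtain ⟨f⟩ := h
  exact ⟨fun w => {f w}, fun w => Set.singleton_nonempty _,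
    fun w w' hww' => Set.disjoint_singleton.2 (f.injective.ne hww'),
    fun w => connectedOn_singleton _ _,
    fun w w' hww' => ⟨f w, rfl, f w', rfl, f.toHom.map_adj hww'⟩⟩

lemma HasModel.map {f : V → W} (hf : f.Surjective)
    (hfib : ∀ w, ConnectedOn G.Adj (f ⁻¹' {w})) : HasModel (G.map f) G := by
  refine ⟨fun w => f ⁻¹' {w}, fun w => hf w, fun w w' hww' => ?_, hfib, fun w w' hww' => ?_⟩
  · exact (Set.disjoint_singleton.2 hww').preimage f
  · obtain ⟨-, u, v, huv, rfl, rfl⟩ := (SimpleGraph.map_adj' ..).1 hww'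
    exact ⟨u, rfl, v, rfl, huv⟩

end SimpleMinors

section UnderlyingSimpleGraph

variable {α β W : Type*} {G : Graph α β} {T : Set (Sym2 V(G))}

instance ofSimpleGraph_loopless (K : SimpleGraph W) : (Graph.ofSimpleGraph K).Loopless where
  not_isLoopAt e x h := by
    obtain ⟨rfl, h⟩ := h
    exact K.loopless.irrefl x h

instance theta_loopless (r : ℕ) : (theta r).Loopless where
  not_isLoopAt e x h := by simp [theta] at h

theorem HasModel.isMinor {K : SimpleGraph W} (h : HasModel K G.toSimpleGraph) (hV : V(G).Finite)
    (hE : E(G).Finite) : IsMinor (Graph.ofSimpleGraph K) G := by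
  obtain ⟨B, hB, hBdisj, hBconn, hBadj⟩ := h
  have exists_edge : ∀ s : K.edgeSet, ∃ e : β, ∀ i j, (s : Sym2 W) = s(i, j) →
      ∃ u ∈ B i, ∃ v ∈ B j, G.IsLink e u v := by
    rintro ⟨⟨i, j⟩, hij⟩
    obtain ⟨u, hu, v, hv, -, e, he⟩ := hBadj i j hij
    refine ⟨e, fun i' j' hs => ?_⟩
    obtain ⟨rfl, rfl⟩ | ⟨rfl, rfl⟩ := Sym2.eq_iff.1 hs
    exacts [⟨u, hu, v, hv, he⟩, ⟨v, hv, u, hu, he.symm⟩]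
  choose ε hε using exists_edge
  have model : IsMinorModel (Graph.ofSimpleGraph K) G (fun i => Subtype.val '' B i) ε := by
    refine ⟨fun i => (hB i).image _, fun i => Subtype.coe_image_subset _ _, fun i j hij => ?_,
      fun i => (hBconn i).image fun u v huv => .inr huv.2, ?_, fun e i j hij => ?_⟩
    · exact (Set.disjoint_image_iff Subtype.val_injective).2 (hBdisj (Subtype.coe_ne_coe.2 hij))
    · rintro ⟨⟨i, j⟩, hij⟩ ⟨⟨i', j'⟩, hij'⟩ heq
      obtain ⟨u, hu, v, hv, huv⟩ := hε ⟨s(i, j), hij⟩ i j rfl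
      obtain ⟨u', hu', v', hv', huv'⟩ := hε ⟨s(i', j'), hij'⟩ i' j' rfl
      refine Subtype.ext (Sym2.eq_iff.2 ?_)
      obtain ⟨h₁, h₂⟩ | ⟨h₁, h₂⟩ := huv.eq_and_eq_or_eq_and_eq (heq ▸ huv') <;>
        obtain rfl := Subtype.ext h₁ <;> obtain rfl := Subtype.ext h₂
      · exact .inl ⟨eq_of_mem_of_mem hBdisj hu hu', eq_of_mem_of_mem hBdisj hv hv'⟩
      · exact .inr ⟨eq_of_mem_of_mem hBdisj hu hv', eq_of_mem_of_mem hBdisj hv hu'⟩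
    · obtain ⟨u, hu, v, hv, huv⟩ := hε e i j hij.1
      exact ⟨u, Set.mem_image_of_mem _ hu, v, Set.mem_image_of_mem _ hv, huv⟩
  exact model.isMinor hV hE

lemma exists_injective_isLink (hT : T ⊆ G.toSimpleGraph.edgeSet) :
    ∃ η : T → β, η.Injective ∧ ∀ x y (h : s(x, y) ∈ T), G.IsLink (η ⟨s(x, y), h⟩) x y := by
  have exists_edge : ∀ s : T, ∃ e : β, ∀ x y, (s : Sym2 V(G)) = s(x, y) → G.IsLink e x y := by
    rintro ⟨⟨x, y⟩, hxy⟩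
    obtain ⟨-, e, he⟩ := hT hxy
    refine ⟨e, fun x' y' hs => ?_⟩
    obtain ⟨rfl, rfl⟩ | ⟨rfl, rfl⟩ := Sym2.eq_iff.1 hs
    exacts [he, he.symm]
  choose η hη using exists_edge
  refine ⟨η, ?_, fun x y h => hη _ x y rfl⟩
  rintro ⟨⟨x, y⟩, hxy⟩ ⟨⟨x', y'⟩, hxy'⟩ heq
  refine Subtype.ext (Sym2.eq_iff.2 ?_)
  have link : G.IsLink (η ⟨s(x, y), hxy⟩) x' y' := heq ▸ hη ⟨s(x', y'), hxy'⟩ x' y' rfl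
  simpa only [Subtype.ext_iff] using (hη ⟨s(x, y), hxy⟩ x y rfl).eq_and_eq_or_eq_and_eq link

lemma isMinor_theta {M : Graph α β} (hV : V(M).Finite) (hE : E(M).Finite) {A A' : Set α}
    (hA : A.Nonempty) (hA' : A'.Nonempty) (hAM : A ⊆ V(M)) (hAM' : A' ⊆ V(M))
    (hAA' : Disjoint A A') (hAconn : ConnectedOn M.Adj A) (hAconn' : ConnectedOn M.Adj A')
    {r : ℕ} {ε : Fin r → β} (hε : ε.Injective)
    (hlink : ∀ i, ∃ u ∈ A, ∃ v ∈ A', M.IsLink (ε i) u v) : IsMinor (theta r) M := by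
  have model : IsMinorModel (theta r) M (fun i => ![A, A'] i) (fun i => ε i) := by
    refine ⟨fun ⟨i, _⟩ => ?_, fun ⟨i, _⟩ => ?_, fun ⟨i, _⟩ ⟨j, _⟩ hij => ?_, fun ⟨i, _⟩ => ?_,
      hε.comp Subtype.val_injective, fun e i j hij => ?_⟩
    · fin_cases i
      exacts [hA, hA']
    · fin_cases i
      exacts [hAM, hAM']
    · fin_cases i <;> fin_cases j
      exacts [absurd rfl hij, hAA', hAA'.symm, absurd rfl hij]
    · fin_cases i
      exacts [hAconn, hAconn']
    · obtain ⟨u, hu, v, hv, huv⟩ := hlink e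
      obtain ⟨-, ⟨hi, hj⟩ | ⟨hi, hj⟩⟩ := hij <;> rw [hi, hj]
      exacts [⟨u, hu, v, hv, huv⟩, ⟨v, hv, u, hu, huv.symm⟩]
  exact model.isMinor hV hE

lemma girth_theta_le_encard (hV : V(G).Finite) (hE : E(G).Finite) {r : ℕ} (hr : 0 < r)
    (hT : T ⊆ G.toSimpleGraph.edgeSet) {A A' : Set V(G)} (hAA' : Disjoint A A')
    (hA : ConnectedOn (fun a b => s(a, b) ∈ T) A) (hA' : ConnectedOn (fun a b => s(a, b) ∈ T) A')
    {x y : Fin r → V(G)} (hxy : (fun i => (x i, y i)).Injective) (hx : ∀ i, x i ∈ A)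
    (hy : ∀ i, y i ∈ A') (hxyT : ∀ i, s(x i, y i) ∈ T) : girth (theta r) G ≤ T.encard := by
  obtain ⟨η, hη, hηlink⟩ := exists_injective_isLink hT
  set M := G.restrict (Set.range η)
  have isLink_M : ∀ u v (h : s(u, v) ∈ T), M.IsLink (η ⟨s(u, v), h⟩) u v := fun u v h =>
    ⟨Set.mem_range_self _, hηlink u v h⟩
  have edges_injective : (fun i => η ⟨s(x i, y i), hxyT i⟩).Injective := by
    intro i j hij
    obtain ⟨hxij, hyij⟩ | ⟨hxij, -⟩ := Sym2.eq_iff.1 (congrArg Subtype.val (hη hij))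
    · exact hxy (Prod.ext hxij hyij)
    · exact (hAA'.ne_of_mem (hx i) (hy j) hxij).elim
  have connected_M : ∀ S : Set V(G), ConnectedOn (fun a b => s(a, b) ∈ T) S →
      ConnectedOn M.Adj (Subtype.val '' S) :=
    fun S hS => hS.image fun u v h => .inr ⟨_, isLink_M u v h⟩
  have theta_minor : IsMinor (theta r) M :=
    isMinor_theta (M := M) hV (hE.subset Graph.restrict_le.edgeSet_mono)
      ⟨_, Set.mem_image_of_mem _ (hx ⟨0, hr⟩)⟩ ⟨_, Set.mem_image_of_mem _ (hy ⟨0, hr⟩)⟩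
      (Subtype.coe_image_subset _ _) (Subtype.coe_image_subset _ _)
      ((Set.disjoint_image_iff Subtype.val_injective).2 hAA') (connected_M A hA)
      (connected_M A' hA') edges_injective fun i => ⟨x i, Set.mem_image_of_mem _ (hx i), y i,
        Set.mem_image_of_mem _ (hy i), isLink_M _ _ (hxyT i)⟩
  calc girth (theta r) G ≤ E(M).encard := sInf_le ⟨M, ⟨Graph.restrict_le, theta_minor⟩, rfl⟩
    _ ≤ (Set.range η).encard := Set.encard_le_encard (by simp [M])
    _ = T.encard := by
      rw [← Set.image_univ, hη.encard_image, Set.encard_univ, ENat.card_coe_set_eq]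

end UnderlyingSimpleGraph

section ThetaSparse

variable {V : Type*} {Γ : SimpleGraph V} {r : ℕ}

/-- The condition that the `θ_r`-girth be at least `z`, in terms of simple graphs: if the edges in a
set `T` connect each of two disjoint sets `A` and `A'` and include at least `r` edges between them,
then `T` has at least `z` elements. -/
def ThetaSparse (Γ : SimpleGraph V) (r : ℕ) (z : ℕ∞) : Prop :=
  ∀ T ⊆ Γ.edgeSet, ∀ A A' : Set V, Disjoint A A' → ConnectedOn (fun a b => s(a, b) ∈ T) A →
    ConnectedOn (fun a b => s(a, b) ∈ T) A' → ∀ F : Finset (V × V),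
      (∀ e ∈ F, e.1 ∈ A ∧ e.2 ∈ A' ∧ s(e.1, e.2) ∈ T) → r ≤ F.card → z ≤ T.encard

lemma thetaSparse_toSimpleGraph {α β : Type*} {G : Graph α β} (hV : V(G).Finite) (hE : E(G).Finite)
    (hr : 0 < r) : ThetaSparse G.toSimpleGraph r (girth (theta r) G) := by
  intro T hT A A' hAA' hA hA' F hF hFcard
  let e : Fin r ↪ F := (Fin.castLEEmb hFcard).trans F.equivFin.symm.toEmbedding
  exact girth_theta_le_encard hV hE hr hT hAA' hA hA'
    (x := fun i => (e i).1.1) (y := fun i => (e i).1.2) (Subtype.val_injective.comp e.injective)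
    (fun i => (hF _ (e i).2).1) (fun i => (hF _ (e i).2).2.1) fun i => (hF _ (e i).2).2.2

lemma ThetaSparse.mono {z z' : ℕ∞} (hz : z ≤ z') (h : ThetaSparse Γ r z') : ThetaSparse Γ r z :=
  fun T hT A A' hAA' hA hA' F hF hFcard => hz.trans (h T hT A A' hAA' hA hA' F hF hFcard)

lemma reflTransGen_of_mem_support {T : Set (Sym2 V)} {S : Set V} {v c : V} (p : Γ.Walk v c)
    (hT : ∀ e ∈ p.edges, e ∈ T) (hS : ∀ w ∈ p.support, w ∈ S) :
    ∀ w ∈ p.support, ReflTransGen (fun a b => s(a, b) ∈ T ∧ a ∈ S ∧ b ∈ S) w c := by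
  induction p with
  | nil =>
    intro w hw
    rw [List.mem_singleton.1 hw]
  | @cons u v c huv p ih =>
    simp only [SimpleGraph.Walk.edges_cons, SimpleGraph.Walk.support_cons,
      List.forall_mem_cons] at hT hS ⊢
    have reach := ih hT.2 hS.2
    exact ⟨.head ⟨hT.1, hS.1, hS.2 v p.start_mem_support⟩ (reach v p.start_mem_support), reach⟩

lemma connectedOn_iUnion_support {ι : Type*} {T : Set (Sym2 V)} {c : V} {x : ι → V}
    (p : ∀ i, Γ.Walk (x i) c) (hT : ∀ i, ∀ e ∈ (p i).edges, e ∈ T) :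
    ConnectedOn (fun a b => s(a, b) ∈ T) (⋃ i, {w | w ∈ (p i).support}) := by
  have : Std.Symm fun a b => s(a, b) ∈ T := ⟨fun _ _ h => Sym2.eq_swap ▸ h⟩
  refine connectedOn_of_reflTransGen (c := c) fun w hw => ?_
  obtain ⟨i, hw⟩ := Set.mem_iUnion.1 hw
  exact reflTransGen_of_mem_support (p i) (hT i) (fun u hu => Set.mem_iUnion.2 ⟨i, hu⟩) w hw

lemma ThetaSparse.card_lt {z : ℕ} (h : ThetaSparse Γ r z) {L : ℕ} (hz : r * (2 * L + 1) < z)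
    {A A' : Set V} (hAA' : Disjoint A A') {c c' : V} {F : Finset (V × V)}
    (hadj : ∀ e ∈ F, Γ.Adj e.1 e.2)
    (hA : ∀ e ∈ F, ∃ p : Γ.Walk e.1 c, p.length ≤ L ∧ ∀ w ∈ p.support, w ∈ A)
    (hA' : ∀ e ∈ F, ∃ p : Γ.Walk e.2 c', p.length ≤ L ∧ ∀ w ∈ p.support, w ∈ A') :
    F.card < r := by
  classical
  by_contra! hF
  obtain ⟨F', hF'F, rfl⟩ := Finset.exists_subset_card_eq hF
  choose p hpL hpA using fun e : F' => hA e (hF'F e.2)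
  choose p' hpL' hpA' using fun e : F' => hA' e (hF'F e.2)
  let q (e : F') : Γ.Walk c c' := (p e).reverse.append (.cons (hadj e (hF'F e.2)) (p' e))
  let T : Finset (Sym2 V) := Finset.univ.biUnion fun e => (q e).edges.toFinset
  have mem_T : ∀ {s}, s ∈ (T : Set (Sym2 V)) ↔ ∃ e, s ∈ (q e).edges := by simp [T]
  have le_card : (z : ℕ∞) ≤ (T : Set (Sym2 V)).encard := by
    refine h T (fun s hs => ?_) (⋃ e, {w | w ∈ (p e).support}) (⋃ e, {w | w ∈ (p' e).support})
      (hAA'.mono (Set.iUnion_subset hpA) (Set.iUnion_subset hpA'))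
      (connectedOn_iUnion_support p fun e s hs => mem_T.2 ⟨e, by simp [q, hs]⟩)
      (connectedOn_iUnion_support p' fun e s hs => mem_T.2 ⟨e, by simp [q, hs]⟩) F'
      (fun e he => ⟨Set.mem_iUnion.2 ⟨⟨e, he⟩, (p ⟨e, he⟩).start_mem_support⟩,
        Set.mem_iUnion.2 ⟨⟨e, he⟩, (p' ⟨e, he⟩).start_mem_support⟩,
        mem_T.2 ⟨⟨e, he⟩, by simp [q]⟩⟩) le_rfl
    obtain ⟨e, hs⟩ := mem_T.1 hs
    exact (q e).edges_subset_edgeSet hs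
  have card_q : ∀ e, (q e).edges.toFinset.card ≤ 2 * L + 1 := fun e => by
    refine (q e).edges.toFinset_card_le.trans ?_
    simp only [q, SimpleGraph.Walk.length_edges, SimpleGraph.Walk.length_append,
      SimpleGraph.Walk.length_reverse, SimpleGraph.Walk.length_cons]
    linarith [hpL e, hpL' e]
  have card_T : T.card ≤ F'.card * (2 * L + 1) := by
    have := Finset.card_biUnion_le_card_mul Finset.univ _ _ fun e _ => card_q e
    rwa [Finset.card_univ, Fintype.card_coe] at this
  rw [Set.encard_coe_eq_coe_finsetCard, Nat.cast_le] at le_card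
  exact hz.not_ge (le_card.trans card_T)

end ThetaSparse

section EdgeDensity

universe u

variable {W : Type u} {H : SimpleGraph W}

lemma exists_le_ncard_edgeSet_eq {n : ℕ} (hn : n ≤ H.edgeSet.ncard) :
    ∃ H' ≤ H, H'.edgeSet.ncard = n := by
  obtain ⟨S, hSH, rfl⟩ := Set.exists_subset_card_eq hn
  refine ⟨.fromEdgeSet S, (SimpleGraph.fromEdgeSet_le _).2 (Set.sdiff_subset.trans hSH), ?_⟩
  rw [SimpleGraph.edgeSet_fromEdgeSet, sdiff_eq_left.2]
  exact Set.disjoint_left.2 fun e he => H.not_isDiag_of_mem_edgeSet (hSH he)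

lemma exists_isNIndepSet_of_cliqueFree_three [Finite W] (hH : H.CliqueFree 3) {k : ℕ}
    (hk : k ^ 2 ≤ Nat.card W) : ∃ S, H.IsNIndepSet k S := by
  classical
  have := Fintype.ofFinite W
  suffices h : ∃ S : Finset W, H.IsIndepSet (S : Set W) ∧ k ≤ S.card by
    obtain ⟨S, hS, hkS⟩ := h
    obtain ⟨T, hTS, hT⟩ := Finset.exists_subset_card_eq hkS
    exact ⟨T, hS.mono (Finset.coe_subset.2 hTS), hT⟩
  by_cases hdeg : ∃ v, k ≤ H.degree v
  · obtain ⟨v, hv⟩ := hdeg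
    exact ⟨H.neighborFinset v, by
      simpa using SimpleGraph.isIndepSet_neighborSet_of_triangleFree H hH v, hv⟩
  push Not at hdeg
  obtain ⟨I, hI, hImax⟩ := H.exists_isNIndepSet_indepNum
  refine ⟨I, hI, ?_⟩
  have cover : Finset.univ ⊆ I.biUnion fun v => insert v (H.neighborFinset v) := by
    intro w _
    by_contra hw
    simp only [Finset.mem_biUnion, Finset.mem_insert, SimpleGraph.mem_neighborFinset, not_exists,
      not_and, not_or] at hw
    have insert_indep : H.IsIndepSet (insert w I : Finset W) := by
      rw [Finset.coe_insert]
      exact hI.insert fun v hv _ => ⟨fun h => (hw v hv).2 h.symm, (hw v hv).2⟩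
    have := insert_indep.card_le_indepNum
    rw [Finset.card_insert_of_notMem fun h => (hw w h).1 rfl] at this
    lia
  have card_le : Nat.card W ≤ I.card * k := by
    rw [Nat.card_eq_fintype_card]
    exact (Finset.card_le_card cover).trans (Finset.card_biUnion_le_card_mul _ _ _ fun v _ =>
      (Finset.card_insert_le _ _).trans (hdeg v))
  rw [sq] at hk
  obtain rfl | hk0 := k.eq_zero_or_pos
  exacts [Nat.zero_le _, Nat.le_of_mul_le_mul_right (hk.trans card_le) hk0]

lemma card_le_ncard_commonNeighbors_add [Finite W]
    (hdeg : ∀ w, Nat.card W ≤ 2 * (H.neighborSet w).ncard) (a b c : W) :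
    Nat.card W ≤ 2 * ((H.commonNeighbors a b).ncard + (H.commonNeighbors a c).ncard +
      (H.commonNeighbors b c).ncard) := by
  simp only [SimpleGraph.commonNeighbors]
  have h₁ := Set.ncard_union_add_ncard_inter (H.neighborSet a) (H.neighborSet b)
  have h₂ := Set.ncard_union_add_ncard_inter (H.neighborSet a ∪ H.neighborSet b) (H.neighborSet c)
  have h₃ := Set.ncard_union_le (H.neighborSet a ∩ H.neighborSet c)
    (H.neighborSet b ∩ H.neighborSet c)
  rw [← Set.union_inter_distrib_right] at h₃
  linarith [Set.ncard_le_card (H.neighborSet a ∪ H.neighborSet b ∪ H.neighborSet c), hdeg a,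
    hdeg b, hdeg c]

lemma exists_pairwise_card_le_ncard_commonNeighbors [Finite W]
    (hdeg : ∀ w, Nat.card W ≤ 2 * (H.neighborSet w).ncard) {k : ℕ} (hk : k ^ 2 ≤ Nat.card W) :
    ∃ S : Finset W, S.card = k ∧
      (S : Set W).Pairwise fun a b => Nat.card W ≤ 6 * (H.commonNeighbors a b).ncard := by
  classical
  let sparse : SimpleGraph W := .fromRel fun a b => 6 * (H.commonNeighbors a b).ncard < Nat.card W
  have adj_iff : ∀ a b, sparse.Adj a b ↔
      a ≠ b ∧ 6 * (H.commonNeighbors a b).ncard < Nat.card W := fun a b => by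
    simp only [sparse, SimpleGraph.fromRel_adj, H.commonNeighbors_symm b a, or_self]
  have cliqueFree : sparse.CliqueFree 3 := fun S hS => by
    obtain ⟨a, b, c, hab, hac, hbc, -⟩ := SimpleGraph.is3Clique_iff.1 hS
    rw [adj_iff] at hab hac hbc
    linarith [card_le_ncard_commonNeighbors_add hdeg a b c]
  obtain ⟨S, hS, hSk⟩ := exists_isNIndepSet_of_cliqueFree_three cliqueFree hk
  exact ⟨S, hSk, fun a ha b hb hab => not_lt.1 fun h => hS ha hb hab ((adj_iff a b).2 ⟨hab, h⟩)⟩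

lemma exists_injective_mem_of_card_le_ncard {ι : Type*} [Finite ι] {t : ι → Set W}
    (ht : ∀ i, (t i).Finite) (hcard : ∀ i, Nat.card ι ≤ (t i).ncard) :
    ∃ c : ι → W, c.Injective ∧ ∀ i, c i ∈ t i := by
  classical
  have := Fintype.ofFinite ι
  have hall : ∀ s : Finset ι, s.card ≤ (s.biUnion fun i => (ht i).toFinset).card := fun s => by
    obtain rfl | ⟨i, hi⟩ := s.eq_empty_or_nonempty
    · exact Nat.zero_le _
    calc s.card ≤ Nat.card ι := Nat.card_eq_fintype_card (α := ι) ▸ s.card_le_univ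
      _ ≤ (ht i).toFinset.card := (hcard i).trans_eq (Set.ncard_eq_toFinset_card _ (ht i))
      _ ≤ _ := Finset.card_le_card
        (Finset.subset_biUnion_of_mem (fun i => (ht i).toFinset) hi)
  simpa using (Finset.all_card_le_biUnion_card_iff_exists_injective _).1 hall

lemma hasModel_top_of_le_ncard_commonNeighbors [Finite W] {ι : Type*} [Finite ι] {f : ι → W}
    (hf : f.Injective) (hcard : Pairwise fun i j =>
      Nat.card ι + Nat.card ι ^ 2 ≤ (H.commonNeighbors (f i) (f j)).ncard) :
    HasModel (⊤ : SimpleGraph ι) H := by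
  obtain ⟨c, hc, hct⟩ := exists_injective_mem_of_card_le_ncard
    (ι := {q : ι × ι // q.1 ≠ q.2})
    (t := fun q => H.commonNeighbors (f q.1.1) (f q.1.2) \ Set.range f) (fun q => Set.toFinite _)
    fun q => by
      have h₁ := Set.le_ncard_sdiff (Set.range f) (H.commonNeighbors (f q.1.1) (f q.1.2))
      have h₂ := Finite.card_subtype_le fun q : ι × ι => q.1 ≠ q.2
      have h₃ := hcard q.2
      rw [Nat.card_prod, ← sq] at h₂
      rw [← Nat.card_coe_set_eq (Set.range f), Nat.card_range_of_injective hf] at h₁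
      lia
  have hcf : ∀ q i, c q ≠ f i := fun q i h => (hct q).2 ⟨i, h.symm⟩
  refine ⟨fun i => insert (f i) {w | ∃ q, q.1.1 = i ∧ c q = w}, fun i => Set.insert_nonempty _ _,
    fun i j hij => Set.disjoint_left.2 ?_, fun i => ?_, fun i j hij => ?_⟩
  · rintro _ (rfl | ⟨q, rfl, rfl⟩) (h | ⟨q', rfl, h⟩)
    exacts [hij (hf h), hcf _ _ h, hcf _ _ h, hij (by rw [hc h])]
  · have := H.symm
    refine connectedOn_of_reflTransGen (c := f i) ?_
    rintro _ (rfl | ⟨q, rfl, rfl⟩)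
    exacts [.refl, .single ⟨(hct q).1.1.symm, .inr ⟨q, rfl, rfl⟩, Set.mem_insert _ _⟩]
  · exact ⟨c ⟨(i, j), hij⟩, .inr ⟨_, rfl, rfl⟩, f j, Set.mem_insert _ _,
      (hct ⟨(i, j), hij⟩).1.2.symm⟩

lemma hasModel_top_of_card_le_ncard_neighborSet [Finite W] {k : ℕ} (hk : 12 * k ^ 2 ≤ Nat.card W)
    (hdeg : ∀ w, Nat.card W ≤ 2 * (H.neighborSet w).ncard) :
    HasModel (⊤ : SimpleGraph (Fin k)) H := by
  obtain ⟨S, hSk, hS⟩ := exists_pairwise_card_le_ncard_commonNeighbors hdeg (k := k) (by lia)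
  let f : Fin k ≃ S := (S.equivFinOfCardEq hSk).symm
  refine hasModel_top_of_le_ncard_commonNeighbors (f := fun i => (f i : W))
    (Subtype.val_injective.comp f.injective) fun i j hij => ?_
  have h := hS (f i).2 (f j).2 (Subtype.coe_ne_coe.2 (f.injective.ne hij))
  have hk_sq : k ≤ k ^ 2 := Nat.le_self_pow two_ne_zero k
  rw [Nat.card_eq_fintype_card, Fintype.card_fin]
  linarith

lemma ncard_edgeSet_induce_compl_singleton_add [Finite W] (v : W) :
    (H.induce {v}ᶜ).edgeSet.ncard + (H.neighborSet v).ncard = H.edgeSet.ncard := by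
  classical
  have := Fintype.ofFinite W
  have h := H.card_edgeFinset_induce_compl_singleton v
  rw [H.card_edgeFinset_deleteIncidenceSet] at h
  have hle := H.degree_le_card_edgeFinset v
  simp only [SimpleGraph.edgeFinset, ← SimpleGraph.card_neighborSet_eq_degree,
    ← Set.toFinset_card, ← Set.ncard_eq_toFinset_card'] at h hle
  lia

lemma sum_ncard_neighborSet [Fintype W] :
    ∑ v, (H.neighborSet v).ncard = 2 * H.edgeSet.ncard := by
  classical
  have h := H.sum_degrees_eq_twice_card_edges
  simpa only [SimpleGraph.edgeFinset, ← SimpleGraph.card_neighborSet_eq_degree,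
    ← Set.toFinset_card, ← Set.ncard_eq_toFinset_card'] using h

lemma ncard_edgeSet_le_of_induce_le [Finite W] {v : W} {u : ({v}ᶜ : Set W)}
    {K : SimpleGraph ({v}ᶜ : Set W)} (hK : H.induce {v}ᶜ ≤ K)
    (hu : ∀ w : ({v}ᶜ : Set W), u ≠ w → H.Adj v w → K.Adj u w) :
    H.edgeSet.ncard ≤ K.edgeSet.ncard + 1 + (H.commonNeighbors u v).ncard := by
  let N : Set ({v}ᶜ : Set W) := {w | u ≠ w ∧ H.Adj v w ∧ ¬ H.Adj u w}
  have card_edges : (H.induce {v}ᶜ).edgeSet.ncard + N.ncard ≤ K.edgeSet.ncard := by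
    have disj : Disjoint (H.induce {v}ᶜ).edgeSet ((fun w => s(u, w)) '' N) :=
      Set.disjoint_right.2 fun e ⟨w, hw, he⟩ h => hw.2.2 (he ▸ h :)
    rw [← Set.ncard_image_of_injective N fun a b => (Sym2.congr_right (a := u)).1,
      ← Set.ncard_union_eq disj]
    refine Set.ncard_le_ncard (Set.union_subset (SimpleGraph.edgeSet_mono hK) ?_)
    rintro _ ⟨w, ⟨huw, hvw, -⟩, rfl⟩
    exact hu w huw hvw
  have nbrs : H.neighborSet v ⊆ insert ↑u (Subtype.val '' N ∪ H.commonNeighbors u v) := by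
    intro w hvw
    by_cases huw : H.Adj u w
    · exact .inr (.inr ⟨huw, hvw⟩)
    · refine (eq_or_ne w u).imp id fun hne => .inl ⟨⟨w, hvw.ne'⟩, ⟨?_, hvw, huw⟩, rfl⟩
      exact fun h => hne (congrArg Subtype.val h).symm
  have card_nbrs := (Set.ncard_le_ncard nbrs).trans (Set.ncard_insert_le _ _)
  have card_union := Set.ncard_union_le (Subtype.val '' N) (H.commonNeighbors u v)
  rw [Set.ncard_image_of_injective _ Subtype.val_injective] at card_union
  linarith [ncard_edgeSet_induce_compl_singleton_add (H := H) v]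

lemma exists_hasModel_contract [Finite W] {u v : W} (huv : H.Adj u v) :
    ∃ H' : SimpleGraph ({v}ᶜ : Set W), HasModel H' H ∧
      H.edgeSet.ncard ≤ H'.edgeSet.ncard + 1 + (H.commonNeighbors u v).ncard := by
  classical
  let f : W → ({v}ᶜ : Set W) := fun w => if h : w = v then ⟨u, huv.ne⟩ else ⟨w, h⟩
  have fv : f v = ⟨u, huv.ne⟩ := dif_pos rfl
  have fw : ∀ w : ({v}ᶜ : Set W), f w = w := fun w => dif_neg w.2
  refine ⟨H.map f, HasModel.map (fun w => ⟨w, fw w⟩) fun w => ?_,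
    ncard_edgeSet_le_of_induce_le (u := ⟨u, huv.ne⟩) (fun x y hxy => ?_) fun w huw hvw => ?_⟩
  · have := H.symm
    refine connectedOn_of_reflTransGen (c := (w : W)) fun x hx => ?_
    obtain rfl | hxv := eq_or_ne x v
    · obtain rfl : w = ⟨u, huv.ne⟩ := hx.symm.trans fv
      exact .single ⟨huv.symm, hx, fw _⟩
    · obtain rfl : ⟨x, hxv⟩ = w := (fw ⟨x, hxv⟩).symm.trans hx
      exact .refl
  · exact (SimpleGraph.map_adj' ..).2 ⟨hxy.ne, x, y, hxy, fw x, fw y⟩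
  · exact (SimpleGraph.map_adj' ..).2 ⟨huw, v, w, hvw, fv, fw w⟩

lemma exists_hasModel_ncard_edgeSet_le [Finite W] {v : W} {m : ℕ}
    (hv : (H.neighborSet v).ncard ≤ m ∨ ∃ u, H.Adj u v ∧ (H.commonNeighbors u v).ncard < m) :
    ∃ H' : SimpleGraph ({v}ᶜ : Set W), HasModel H' H ∧
      H.edgeSet.ncard ≤ H'.edgeSet.ncard + m := by
  obtain hv | ⟨u, huv, hcn⟩ := hv
  · refine ⟨_, .of_isContained (SimpleGraph.Embedding.induce {v}ᶜ).isContained, ?_⟩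
    linarith [ncard_edgeSet_induce_compl_singleton_add (H := H) v]
  · obtain ⟨H', hH', hcard⟩ := exists_hasModel_contract huv
    exact ⟨H', hH', by lia⟩

lemma exists_hasModel_locally_dense [Finite W] [Nonempty W] {m : ℕ}
    (hm : 0 < m) (he : m * Nat.card W ≤ H.edgeSet.ncard) :
    ∃ (U : Type u) (_ : Finite U) (K : SimpleGraph U) (v : U), HasModel K H ∧
      m ≤ (K.neighborSet v).ncard ∧ (K.neighborSet v).ncard ≤ 2 * m ∧
      ∀ u, K.Adj v u → m ≤ (K.commonNeighbors v u).ncard := by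
  induction hn : Nat.card W using Nat.strong_induction_on generalizing W with
  | _ n ih =>
  obtain ⟨H₀, hH₀, he₀⟩ := exists_le_ncard_edgeSet_eq he
  have model₀ : HasModel H₀ H := .of_isContained (.of_le hH₀)
  by_cases hred : ∃ v, (H₀.neighborSet v).ncard ≤ m ∨
      ∃ u, H₀.Adj u v ∧ (H₀.commonNeighbors u v).ncard < m
  · obtain ⟨v, hv⟩ := hred
    obtain ⟨H', hH', hcard⟩ := exists_hasModel_ncard_edgeSet_le hv
    have card_compl : Nat.card ({v}ᶜ : Set W) + 1 = n := by
      rw [Nat.card_coe_set_eq, ← hn, ← Set.ncard_add_ncard_compl {v}, Set.ncard_singleton, add_comm]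
    have : Nonempty ({v}ᶜ : Set W) := by
      obtain ⟨⟨x, y⟩, hxy⟩ : H₀.edgeSet.Nonempty :=
        Set.nonempty_of_ncard_ne_zero (he₀ ▸ Nat.mul_ne_zero hm.ne' Nat.card_pos.ne')
      have : Nontrivial W := ⟨x, y, SimpleGraph.Adj.ne hxy⟩
      exact nonempty_subtype.2 (exists_ne v)
    obtain ⟨U, hU, K, w, hK, hw⟩ := ih _ (by lia) (H := H') (by
      rw [he₀, hn, ← card_compl] at hcard
      linarith) rfl
    exact ⟨U, hU, K, w, (hK.trans hH').trans model₀, hw⟩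
  · push Not at hred
    have := Fintype.ofFinite W
    obtain ⟨v, -, hv⟩ : ∃ v ∈ (Finset.univ : Finset W), (H₀.neighborSet v).ncard ≤ 2 * m := by
      refine Finset.exists_le_of_sum_le Finset.univ_nonempty ?_
      rw [sum_ncard_neighborSet, he₀, Finset.sum_const, Finset.card_univ, smul_eq_mul,
        Nat.card_eq_fintype_card]
      exact (by ring : 2 * (m * Fintype.card W) = Fintype.card W * (2 * m)).le
    exact ⟨W, inferInstance, H₀, v, model₀, (hred v).1.le, hv, fun u hu => (hred u).2 v hu⟩

theorem hasModel_top_of_mul_card_le [Finite W] [Nonempty W] {k : ℕ} (hk : 0 < k)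
    (he : 12 * k ^ 2 * Nat.card W ≤ H.edgeSet.ncard) :
    HasModel (⊤ : SimpleGraph (Fin k)) H := by
  obtain ⟨U, _, K, v, hK, hv, hv', hcn⟩ := exists_hasModel_locally_dense (by positivity) he
  refine (hasModel_top_of_card_le_ncard_neighborSet (H := K.induce (K.neighborSet v)) hv
    fun u => ?_).trans (.trans (.of_isContained (SimpleGraph.Embedding.induce _).isContained) hK)
  have neighborSet_image : Subtype.val '' (K.induce (K.neighborSet v)).neighborSet u =
      K.commonNeighbors v u := by
    ext w
    simp [SimpleGraph.mem_commonNeighbors, and_comm]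
  rw [← Set.ncard_image_of_injective _ Subtype.val_injective, neighborSet_image]
  exact hv'.trans (Nat.mul_le_mul_left 2 (hcn u u.2))

theorem hasModel_top_of_le_degree [Finite W] [Nonempty W] {k : ℕ}
    (hk : 0 < k) (hH : ∀ w, 24 * k ^ 2 ≤ (H.neighborSet w).ncard) :
    HasModel (⊤ : SimpleGraph (Fin k)) H := by
  have := Fintype.ofFinite W
  have h := Finset.card_nsmul_le_sum Finset.univ _ _ fun w _ => hH w
  rw [sum_ncard_neighborSet, Finset.card_univ, ← Nat.card_eq_fintype_card, smul_eq_mul] at h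
  exact hasModel_top_of_mul_card_le hk (by linarith)

end EdgeDensity

section RootedForest

variable {V : Type*} {Γ : SimpleGraph V}

/-- A rooted spanning forest of `Γ`: `level v` is the depth of `v`, and the roots are the vertices
of level `0`. The value of `parent` at a root is arbitrary. -/
structure RootedForest (Γ : SimpleGraph V) where
  level : V → ℕ
  parent : V → V
  adj_parent {v : V} : 0 < level v → Γ.Adj v (parent v)
  level_parent {v : V} : 0 < level v → level (parent v) + 1 = level v

namespace RootedForest

variable (T : RootedForest Γ)

/-- The root of the tree containing `v`. -/
def root (v : V) : V := T.parent^[T.level v] v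

/-- The Voronoi condition: every tree has height at most `2 * R` and contains the ball of radius `R`
around its root, and levels are distances to the set of roots. -/
structure IsVoronoi (R : ℕ) : Prop where
  level_le (v : V) : T.level v ≤ 2 * R
  level_le_succ {u w : V} : Γ.Adj u w → T.level w ≤ T.level u + 1
  root_eq_of_adj {u w : V} : Γ.Adj u w → T.level u < R → T.root w = T.root u

@[elab_as_elim]
lemma induction {P : V → Prop} (root : ∀ v, T.level v = 0 → P v)
    (parent : ∀ v, 0 < T.level v → P (T.parent v) → P v) (v : V) : P v := by
  induction h : T.level v generalizing v with
  | zero => exact root v h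
  | succ n ih =>
    have hv : 0 < T.level v := h ▸ n.succ_pos
    exact parent v hv (ih _ (Nat.succ_injective ((T.level_parent hv).trans h)))

lemma root_eq_self {v : V} (hv : T.level v = 0) : T.root v = v := by
  rw [root, hv, iterate_zero_apply]

lemma root_parent {v : V} (hv : 0 < T.level v) : T.root (T.parent v) = T.root v := by
  rw [root, root, ← T.level_parent hv, iterate_succ_apply]

lemma level_root (v : V) : T.level (T.root v) = 0 := by
  induction v using T.induction with
  | root v hv => rwa [T.root_eq_self hv]
  | parent v hv ih => rwa [← T.root_parent hv]

lemma root_root (v : V) : T.root (T.root v) = T.root v := T.root_eq_self (T.level_root v)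

lemma exists_walk_root (v : V) : ∃ p : Γ.Walk v (T.root v), p.length = T.level v ∧
    ∀ w ∈ p.support, T.root w = T.root v ∧ (w = v ∨ T.level w < T.level v) := by
  induction v using T.induction with
  | root v hv =>
    rw [T.root_eq_self hv, hv]
    refine ⟨.nil, rfl, fun w hw => ?_⟩
    obtain rfl := List.mem_singleton.1 hw
    exact ⟨T.root_eq_self hv, .inl rfl⟩
  | parent v hv ih =>
    rw [← T.root_parent hv, ← T.level_parent hv]
    obtain ⟨p, hp, hsupp⟩ := ih
    refine ⟨.cons (T.adj_parent hv) p, by rw [SimpleGraph.Walk.length_cons, hp], ?_⟩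
    rw [SimpleGraph.Walk.support_cons, List.forall_mem_cons]
    refine ⟨⟨(T.root_parent hv).symm, .inl rfl⟩, fun w hw => ⟨(hsupp w hw).1, .inr ?_⟩⟩
    obtain ⟨-, rfl | hlt⟩ := hsupp w hw
    exacts [Nat.lt_succ_self _, hlt.trans (Nat.lt_succ_self _)]

lemma connectedOn_root_fiber (c : V) : ConnectedOn Γ.Adj {v | T.root v = c} := by
  have := Γ.symm
  refine connectedOn_of_reflTransGen (c := c) fun v hv => ?_
  induction v using T.induction with
  | root v hv₀ =>
    obtain rfl : T.root v = c := hv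
    rw [T.root_eq_self hv₀]
  | parent v hv₀ ih =>
    have hparent : T.root (T.parent v) = c := (T.root_parent hv₀).trans hv
    exact .head ⟨T.adj_parent hv₀, hv, hparent⟩ (ih hparent)

/-- The graph obtained from `Γ` by contracting every tree of the forest. -/
def quotient : SimpleGraph (Set.range T.root) := Γ.map (Set.rangeFactorization T.root)

lemma hasModel_quotient : HasModel T.quotient Γ :=
  .map Set.rangeFactorization_surjective fun w => by
    convert T.connectedOn_root_fiber w using 1
    exact Set.ext fun v => Subtype.ext_iff

lemma quotient_adj_of_adj {u w : V} (huw : Γ.Adj u w) (h : T.root u ≠ T.root w) :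
    T.quotient.Adj (Set.rangeFactorization T.root u) (Set.rangeFactorization T.root w) :=
  (SimpleGraph.map_adj' ..).2 ⟨fun heq => h (congrArg Subtype.val heq), u, w, huw, rfl, rfl⟩

lemma exists_of_cover {C : Set V} (hC : ∀ v, ∃ c ∈ C, Γ.Reachable v c) :
    ∃ T : RootedForest Γ, (∀ v, T.level v = 0 → v ∈ C) ∧
      ∀ v, ∀ c ∈ C, ∀ p : Γ.Walk v c, T.level v ≤ p.length := by
  let lengths (v : V) : Set ℕ := {n | ∃ c ∈ C, ∃ p : Γ.Walk v c, p.length = n}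
  have sInf_mem : ∀ v, sInf (lengths v) ∈ lengths v := fun v => by
    obtain ⟨c, hc, ⟨p⟩⟩ := hC v
    exact Nat.sInf_mem ⟨_, c, hc, p, rfl⟩
  have sInf_le : ∀ v, ∀ c ∈ C, ∀ p : Γ.Walk v c, sInf (lengths v) ≤ p.length :=
    fun v c hc p => Nat.sInf_le ⟨c, hc, p, rfl⟩
  have exists_parent : ∀ v, ∃ u, 0 < sInf (lengths v) →
      Γ.Adj v u ∧ sInf (lengths u) + 1 = sInf (lengths v) := by
    intro v
    obtain ⟨c, hc, p, hp⟩ := sInf_mem v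
    cases p with
    | nil => exact ⟨v, fun hpos => absurd hp hpos.ne⟩
    | @cons _ u _ hvu p =>
      obtain ⟨c', hc', p', hp'⟩ := sInf_mem u
      have le_u := sInf_le u c hc p
      have le_v := sInf_le v c' hc' (.cons hvu p')
      rw [SimpleGraph.Walk.length_cons] at hp le_v
      exact ⟨u, fun _ => ⟨hvu, by omega⟩⟩
  choose parent hparent using exists_parent
  refine ⟨⟨fun v => sInf (lengths v), parent, fun hv => (hparent _ hv).1,
    fun hv => (hparent _ hv).2⟩, fun v (hv : sInf (lengths v) = 0) => ?_, sInf_le⟩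
  obtain ⟨c, hc, p, hp⟩ := sInf_mem v
  rwa [SimpleGraph.Walk.eq_of_length_eq_zero (hp.trans hv)]

end RootedForest

lemma exists_maximal_separated [Finite V] (Γ : SimpleGraph V) (N : ℕ) :
    ∃ C : Set V, (∀ a ∈ C, ∀ b ∈ C, ∀ p : Γ.Walk a b, p.length ≤ N → a = b) ∧
      ∀ v, ∃ c ∈ C, ∃ p : Γ.Walk v c, p.length ≤ N := by
  obtain ⟨C, hC⟩ := Set.Finite.exists_maximal
    (s := {C : Set V | ∀ a ∈ C, ∀ b ∈ C, ∀ p : Γ.Walk a b, p.length ≤ N → a = b})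
    (Set.toFinite _) ⟨∅, by simp⟩
  refine ⟨C, hC.prop, fun v => ?_⟩
  by_contra! hv
  have insert_separated :
      ∀ a ∈ insert v C, ∀ b ∈ insert v C, ∀ p : Γ.Walk a b, p.length ≤ N → a = b := by
    rintro a (rfl | ha) b (rfl | hb) p hp
    · rfl
    · exact absurd hp (hv b hb p).not_ge
    · exact absurd hp (p.length_reverse ▸ hv a ha p.reverse).not_ge
    · exact hC.prop a ha b hb p hp
  have hvC : v ∈ C := hC.le_of_ge insert_separated (Set.subset_insert _ _) (Set.mem_insert _ _)
  exact absurd (hv v hvC .nil) (Nat.zero_le _).not_gt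

lemma RootedForest.exists_isVoronoi [Finite V] (Γ : SimpleGraph V) (R : ℕ) :
    ∃ T : RootedForest Γ, T.IsVoronoi R := by
  obtain ⟨C, separated, cover⟩ := exists_maximal_separated Γ (2 * R)
  obtain ⟨T, mem_C, level_le⟩ := RootedForest.exists_of_cover (Γ := Γ) (C := C) fun v => by
    obtain ⟨c, hc, p, -⟩ := cover v
    exact ⟨c, hc, ⟨p⟩⟩
  have root_mem : ∀ v, T.root v ∈ C := fun v => mem_C _ (T.level_root v)
  have level_le_succ : ∀ {u w}, Γ.Adj u w → T.level w ≤ T.level u + 1 := fun {u w} huw => by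
    obtain ⟨p, hp, -⟩ := T.exists_walk_root u
    rw [← hp]
    exact level_le w _ (root_mem u) (.cons huw.symm p)
  refine ⟨T, fun v => ?_, level_le_succ, fun {u w} huw hu => ?_⟩
  · obtain ⟨c, hc, p, hp⟩ := cover v
    exact (level_le v c hc p).trans hp
  · obtain ⟨p, hp, -⟩ := T.exists_walk_root u
    obtain ⟨q, hq, -⟩ := T.exists_walk_root w
    refine separated _ (root_mem w) _ (root_mem u) (q.reverse.append (.cons huw.symm p)) ?_
    rw [SimpleGraph.Walk.length_append, SimpleGraph.Walk.length_reverse,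
      SimpleGraph.Walk.length_cons, hp, hq]
    have := level_le_succ huw
    omega

end RootedForest

section Counting

open scoped Finset

namespace RootedForest

variable {V : Type*} [Fintype V] [DecidableEq V] {Γ : SimpleGraph V} {T : RootedForest Γ}
  {R L r d z : ℕ}

/-- The vertices of the tree with root `c`. -/
def cell (T : RootedForest Γ) (c : V) : Finset V := {v | T.root v = c}

/-- The vertices of level `i` in the tree with root `c`. -/
def cellLevel (T : RootedForest Γ) (c : V) (i : ℕ) : Finset V := {v | T.root v = c ∧ T.level v = i}

lemma mem_cell {c v : V} : v ∈ T.cell c ↔ T.root v = c := Finset.mem_filter_univ v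

lemma mem_cellLevel {c v : V} {i : ℕ} :
    v ∈ T.cellLevel c i ↔ T.root v = c ∧ T.level v = i := Finset.mem_filter_univ v

variable [DecidableRel Γ.Adj]

/-- The neighbours of `u` in its own tree which are not further from the root than `u`. -/
def lowNeighbors (T : RootedForest Γ) (u : V) : Finset V :=
  {w | Γ.Adj u w ∧ T.root w = T.root u ∧ T.level w ≤ T.level u}

/-- The edges from the tree with root `c` to the tree with root `c'`, as ordered pairs; each edge
inside a tree is thus counted twice in `T.edgesBetween c c`. -/
def edgesBetween (T : RootedForest Γ) (c c' : V) : Finset (V × V) :=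
  {e | Γ.Adj e.1 e.2 ∧ T.root e.1 = c ∧ T.root e.2 = c'}

lemma mem_lowNeighbors {u w : V} :
    w ∈ T.lowNeighbors u ↔ Γ.Adj u w ∧ T.root w = T.root u ∧ T.level w ≤ T.level u :=
  Finset.mem_filter_univ w

lemma mem_edgesBetween {c c' : V} {e : V × V} :
    e ∈ T.edgesBetween c c' ↔ Γ.Adj e.1 e.2 ∧ T.root e.1 = c ∧ T.root e.2 = c' :=
  Finset.mem_filter_univ e

lemma card_lowNeighbors_lt (hΓ : ThetaSparse Γ r z) (hz : r * (2 * L + 1) < z)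
    (hL : ∀ v, T.level v ≤ L) (u : V) : #(T.lowNeighbors u) < r := by
  rw [← Finset.card_map ⟨fun w => (w, u), Prod.mk_left_injective u⟩]
  refine hΓ.card_lt hz (A := {u}ᶜ) (A' := {u}) (c := T.root u) (c' := u) disjoint_compl_left
    ?_ ?_ ?_ <;> simp only [Finset.forall_mem_map, mem_lowNeighbors,
      Embedding.coeFn_mk] <;> intro w ⟨huw, hroot, hlevel⟩
  · exact huw.symm
  · obtain ⟨p, hp, hsupp⟩ := T.exists_walk_root w
    rw [← hroot]
    refine ⟨p, hp ▸ hL w, fun x hx (hxu : x = u) => ?_⟩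
    subst hxu
    obtain ⟨-, hxw | hlt⟩ := hsupp x hx
    exacts [huw.ne hxw, hlt.not_ge hlevel]
  · exact ⟨.nil, Nat.zero_le _, fun x hx => List.mem_singleton.1 hx⟩

lemma card_edgesBetween_lt (hΓ : ThetaSparse Γ r z) (hz : r * (2 * L + 1) < z)
    (hL : ∀ v, T.level v ≤ L) {c c' : V} (hcc' : c ≠ c') : #(T.edgesBetween c c') < r := by
  have walk_in_cell : ∀ v, ∃ p : Γ.Walk v (T.root v), p.length ≤ L ∧
      ∀ w ∈ p.support, w ∈ {w | T.root w = T.root v} := fun v => by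
    obtain ⟨p, hp, hsupp⟩ := T.exists_walk_root v
    exact ⟨p, hp ▸ hL v, fun w hw => (hsupp w hw).1⟩
  have disjoint_cells : Disjoint {w | T.root w = c} {w | T.root w = c'} :=
    Set.disjoint_left.2 fun w hc hc' => hcc' (hc.symm.trans hc')
  refine hΓ.card_lt hz disjoint_cells (c := c) (c' := c') ?_ ?_ ?_ <;>
    simp only [mem_edgesBetween] <;> rintro e ⟨he, rfl, rfl⟩
  exacts [he, walk_in_cell e.1, walk_in_cell e.2]

-- Inside the ball of radius `R` all neighbours but the low ones lie one level up in the same tree.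
lemma card_cellLevel_mul_le (hT : T.IsVoronoi R) (hlow : ∀ u, #(T.lowNeighbors u) ≤ r)
    (hd : ∀ v, d ≤ Γ.degree v) (c : V) {i : ℕ} (hi : i < R) :
    #(T.cellLevel c i) * (d - r) ≤ #(T.cellLevel c (i + 1)) * r := by
  refine Finset.card_mul_le_card_mul Γ.Adj (fun u hu => ?_) fun w hw => ?_
  · obtain ⟨rfl, rfl⟩ := mem_cellLevel.1 hu
    have neighbors_subset : Γ.neighborFinset u ⊆ Finset.bipartiteAbove Γ.Adj
        (T.cellLevel (T.root u) (T.level u + 1)) u ∪ T.lowNeighbors u := fun w hw => by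
      have huw : Γ.Adj u w := (Γ.mem_neighborFinset u w).1 hw
      have hroot := hT.root_eq_of_adj huw hi
      have hlevel := hT.level_le_succ huw
      simp only [Finset.mem_union, Finset.mem_bipartiteAbove, mem_cellLevel, mem_lowNeighbors]
      grind
    have := (Finset.card_le_card neighbors_subset).trans (Finset.card_union_le _ _)
    rw [Γ.card_neighborFinset_eq_degree] at this
    have := hd u
    have := hlow u
    omega
  · obtain ⟨rfl, hw⟩ := mem_cellLevel.1 hw
    refine (Finset.card_le_card fun u hu => ?_).trans (hlow w)
    simp only [Finset.mem_bipartiteBelow, mem_cellLevel, mem_lowNeighbors] at hu ⊢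
    exact ⟨hu.2.symm, hu.1.1, by omega⟩

lemma pow_le_card_cellLevel (hT : T.IsVoronoi R) (hr : 0 < r) (hrd : r ≤ d)
    (hlow : ∀ u, #(T.lowNeighbors u) ≤ r) (hd : ∀ v, d ≤ Γ.degree v) (v : V) {i : ℕ}
    (hi : i ≤ R) : ((d : ℝ) / r - 1) ^ i ≤ #(T.cellLevel (T.root v) i) := by
  have hr' : (0 : ℝ) < r := Nat.cast_pos.2 hr
  have hx : (0 : ℝ) ≤ d / r - 1 := sub_nonneg.2 ((one_le_div₀ hr').2 (Nat.cast_le.2 hrd))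
  induction i with
  | zero =>
    rw [pow_zero, Nat.one_le_cast, Finset.one_le_card]
    exact ⟨T.root v, mem_cellLevel.2 ⟨T.root_root v, T.level_root v⟩⟩
  | succ i ih =>
    have growth : (#(T.cellLevel (T.root v) i) : ℝ) * (d - r) ≤
        #(T.cellLevel (T.root v) (i + 1)) * r := by
      rw [← Nat.cast_sub hrd]
      exact_mod_cast card_cellLevel_mul_le hT hlow hd _ hi
    calc ((d : ℝ) / r - 1) ^ (i + 1)
      _ ≤ #(T.cellLevel (T.root v) i) * ((d : ℝ) / r - 1) := by
        rw [pow_succ]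
        exact mul_le_mul_of_nonneg_right (ih (by omega)) hx
      _ = #(T.cellLevel (T.root v) i) * (d - r) / r := by field_simp
      _ ≤ #(T.cellLevel (T.root v) (i + 1)) := (div_le_iff₀ hr').2 growth

lemma mul_card_cell_le_card_edges (hd : ∀ v, d ≤ Γ.degree v) (c : V) :
    d * #(T.cell c) ≤ #{e : V × V | Γ.Adj e.1 e.2 ∧ T.root e.1 = c} := by
  refine Finset.mul_card_image_le_card_of_maps_to (f := Prod.fst) ?_ d fun u hu => ?_
  · exact fun e he => mem_cell.2 ((Finset.mem_filter_univ e).1 he).2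
  · refine (hd u).trans (Finset.card_le_card_of_injOn (Prod.mk u) (fun w hw => ?_)
      (Prod.mk_right_injective u).injOn)
    have huw : Γ.Adj u w := (Γ.mem_neighborFinset u w).1 hw
    exact Finset.mem_filter.2 ⟨(Finset.mem_filter_univ _).2 ⟨huw, mem_cell.1 hu⟩, rfl⟩

-- Each edge inside a tree leads from one of its ends to a low neighbour of that end.
lemma card_edgesBetween_self_le (hlow : ∀ u, #(T.lowNeighbors u) ≤ r) (c : V) :
    #(T.edgesBetween c c) ≤ 2 * (#(T.cell c) * r) := by
  let down := (T.cell c).biUnion fun u => (T.lowNeighbors u).image (Prod.mk u)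
  have card_down : #down ≤ #(T.cell c) * r :=
    Finset.card_biUnion_le_card_mul _ _ _ fun u _ => Finset.card_image_le.trans (hlow u)
  have mem_down : ∀ {u w}, Γ.Adj u w → T.root u = c → T.root w = c → T.level w ≤ T.level u →
      (u, w) ∈ down := fun {u w} huw hu hw hle =>
    Finset.mem_biUnion.2 ⟨u, mem_cell.2 hu, Finset.mem_image_of_mem _
      (mem_lowNeighbors.2 ⟨huw, hw.trans hu.symm, hle⟩)⟩
  have subset_union : T.edgesBetween c c ⊆ down ∪ down.image Prod.swap := by
    rintro ⟨u, w⟩ he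
    obtain ⟨huw, hu, hw⟩ := mem_edgesBetween.1 he
    obtain hle | hle := le_total (T.level w) (T.level u)
    · exact Finset.mem_union_left _ (mem_down huw hu hw hle)
    · exact Finset.mem_union_right _ (Finset.mem_image_of_mem _ (mem_down huw.symm hw hu hle))
  calc #(T.edgesBetween c c) ≤ #down + #(down.image Prod.swap) :=
        (Finset.card_le_card subset_union).trans (Finset.card_union_le _ _)
    _ ≤ 2 * (#(T.cell c) * r) := by
      rw [two_mul]
      exact add_le_add card_down (Finset.card_image_le.trans card_down)

lemma card_edges_leaving_le (hbetween : ∀ c c', c ≠ c' → #(T.edgesBetween c c') ≤ r)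
    (c : Set.range T.root) [Fintype (T.quotient.neighborSet c)] :
    #{e : V × V | Γ.Adj e.1 e.2 ∧ T.root e.1 = c ∧ T.root e.2 ≠ c} ≤
      r * T.quotient.degree c := by
  refine Finset.card_le_mul_card_image_of_maps_to
    (f := fun e => Set.rangeFactorization T.root e.2) (fun e he => ?_) r fun c' hc' => ?_
  · obtain ⟨hadj, hc, hne⟩ := (Finset.mem_filter_univ _).1 he
    rw [SimpleGraph.mem_neighborFinset, ← Subtype.coe_eta c c.2]
    simp only [← hc] at hne ⊢
    exact T.quotient_adj_of_adj hadj hne.symm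
  · have hne : (c : V) ≠ c' := Subtype.coe_ne_coe.2 ((SimpleGraph.mem_neighborFinset ..).1 hc').ne
    refine (Finset.card_le_card fun e he => ?_).trans (hbetween c c' hne)
    obtain ⟨he, hroot⟩ := Finset.mem_filter.1 he
    obtain ⟨hadj, hc, -⟩ := (Finset.mem_filter_univ e).1 he
    exact mem_edgesBetween.2 ⟨hadj, hc, congrArg Subtype.val hroot⟩

lemma mul_card_cell_le (hlow : ∀ u, #(T.lowNeighbors u) ≤ r)
    (hbetween : ∀ c c', c ≠ c' → #(T.edgesBetween c c') ≤ r) (hd : ∀ v, d ≤ Γ.degree v)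
    (c : Set.range T.root) [Fintype (T.quotient.neighborSet c)] :
    d * #(T.cell c) ≤ r * T.quotient.degree c + 2 * (#(T.cell c) * r) := by
  refine (mul_card_cell_le_card_edges hd _).trans ((Finset.card_le_card fun e he => ?_).trans
    ((Finset.card_union_le _ _).trans
      (add_le_add (card_edges_leaving_le hbetween c) (card_edgesBetween_self_le hlow c))))
  obtain ⟨hadj, hc⟩ := (Finset.mem_filter_univ _).1 he
  obtain h | h := eq_or_ne (T.root e.2) c
  · exact Finset.mem_union_right _ (mem_edgesBetween.2 ⟨hadj, hc, h⟩)
  · exact Finset.mem_union_left _ ((Finset.mem_filter_univ _).2 ⟨hadj, hc, h⟩)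

theorem le_degree_quotient (hT : T.IsVoronoi R) (hr : 0 < r) (hrd : 2 * r ≤ d)
    (hlow : ∀ u, #(T.lowNeighbors u) ≤ r)
    (hbetween : ∀ c c', c ≠ c' → #(T.edgesBetween c c') ≤ r) (hd : ∀ v, d ≤ Γ.degree v)
    (c : Set.range T.root) [Fintype (T.quotient.neighborSet c)] :
    ((d : ℝ) / r - 2) * ((d : ℝ) / r - 1) ^ R ≤ T.quotient.degree c := by
  have hr' : (0 : ℝ) < r := Nat.cast_pos.2 hr
  have hx : (0 : ℝ) ≤ d / r - 2 := by
    rw [sub_nonneg, le_div_iff₀ hr']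
    exact_mod_cast hrd
  have pow_le_card : ((d : ℝ) / r - 1) ^ R ≤ #(T.cell c) := by
    obtain ⟨_, v, rfl⟩ := c
    refine (pow_le_card_cellLevel hT hr (by omega) hlow hd v le_rfl).trans ?_
    exact Nat.cast_le.2 (Finset.card_le_card (Finset.monotone_filter_right _ fun _ _ h => h.1))
  have card_le : (d : ℝ) * #(T.cell c) ≤ r * T.quotient.degree c + 2 * (#(T.cell c) * r) := by
    exact_mod_cast mul_card_cell_le hlow hbetween hd c
  calc ((d : ℝ) / r - 2) * ((d : ℝ) / r - 1) ^ R
    _ ≤ ((d : ℝ) / r - 2) * #(T.cell c) := mul_le_mul_of_nonneg_left pow_le_card hx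
    _ = (d * #(T.cell c) - 2 * (#(T.cell c) * r)) / r := by field_simp
    _ ≤ T.quotient.degree c := by
      rw [div_le_iff₀ hr']
      linarith

end RootedForest

end Counting

section CliqueMinors

variable {V : Type*} {Γ : SimpleGraph V} {r d z k : ℕ}

lemma hasModel_top_fin_two (hΓ : Γ ≠ ⊥) : HasModel (⊤ : SimpleGraph (Fin 2)) Γ :=
  .of_isContained ((SimpleGraph.not_cliqueFree_iff_top_isContained 2).1
    (mt SimpleGraph.cliqueFree_two.1 hΓ))

lemma ncard_neighborSet_eq_degree (v : V) [Fintype (Γ.neighborSet v)] :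
    (Γ.neighborSet v).ncard = Γ.degree v := by
  rw [Set.ncard_eq_toFinset_card', Set.toFinset_card, Γ.card_neighborSet_eq_degree]

lemma hasModel_top_of_sq_le_mul_pow [Finite V] [Nonempty V] {R : ℕ} (hr : 0 < r) (hrd : 2 * r ≤ d)
    (hz : r * (2 * (2 * R) + 1) < z) (hΓ : ThetaSparse Γ r z)
    (hd : ∀ v, d ≤ (Γ.neighborSet v).ncard) (hk : 0 < k)
    (hkR : 24 * (k : ℝ) ^ 2 ≤ ((d : ℝ) / r - 2) * ((d : ℝ) / r - 1) ^ R) :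
    HasModel (⊤ : SimpleGraph (Fin k)) Γ := by
  classical
  have := Fintype.ofFinite V
  obtain ⟨T, hT⟩ := RootedForest.exists_isVoronoi Γ R
  simp only [ncard_neighborSet_eq_degree] at hd
  refine (hasModel_top_of_le_degree hk fun c => ?_).trans T.hasModel_quotient
  have le_degree := RootedForest.le_degree_quotient hT hr hrd
    (fun u => (RootedForest.card_lowNeighbors_lt hΓ hz hT.level_le u).le)
    (fun c c' hcc' => (RootedForest.card_edgesBetween_lt hΓ hz hT.level_le hcc').le)
    hd c
  rw [ncard_neighborSet_eq_degree]
  exact_mod_cast hkR.trans le_degree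

lemma exists_radius (hr : 0 < r) (hz : 2 * r ≤ z) :
    ∃ R, r * (2 * (2 * R) + 1) < z ∧ z ≤ (4 * R + 6) * r := by
  have hq : 2 ≤ z / r := (Nat.le_div_iff_mul_le hr).2 hz
  have le_z : z / r * r ≤ z := Nat.div_mul_le_self z r
  have z_lt : z < r * (z / r + 1) := Nat.lt_mul_div_succ z hr
  refine ⟨(z / r - 2) / 4, ?_, ?_⟩
  · nlinarith [show 4 * ((z / r - 2) / 4) + 2 ≤ z / r by omega]
  · nlinarith [show z / r + 1 ≤ 4 * ((z / r - 2) / 4) + 6 by omega]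

lemma rpow_div_eight_le {x t : ℝ} {R : ℕ} (hx : 3 ≤ x) (ht : t ≤ 4 * R + 6) :
    x ^ (t / 8) ≤ 3 * ((x - 2) * (x - 1) ^ R) := by
  have hx₀ : 0 ≤ x := by linarith
  have sqrt_le : √x ≤ x - 1 := by
    rw [Real.sqrt_le_left (by linarith)]
    nlinarith
  calc x ^ (t / 8) ≤ x ^ (1 + 1 / 2 * (R : ℝ)) :=
        Real.rpow_le_rpow_of_exponent_le (by linarith) (by linarith)
    _ = x * √x ^ R := by
      rw [Real.rpow_add (by linarith), Real.rpow_one, Real.rpow_mul_natCast hx₀,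
        ← Real.sqrt_eq_rpow]
    _ ≤ 3 * (x - 2) * (x - 1) ^ R := by
      gcongr <;> linarith
    _ = 3 * ((x - 2) * (x - 1) ^ R) := mul_assoc ..

theorem hasModel_top_of_sq_le_rpow [Finite V] [Nonempty V] (hr : 0 < r) (hrd : 3 * r ≤ d)
    (hΓ : ThetaSparse Γ r z) (hd : ∀ v, d ≤ (Γ.neighborSet v).ncard) (hk : 0 < k)
    (hkx : 72 * (k : ℝ) ^ 2 ≤ ((d : ℝ) / r) ^ ((z : ℝ) / r / 8)) :
    HasModel (⊤ : SimpleGraph (Fin k)) Γ := by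
  have hr' : (0 : ℝ) < r := Nat.cast_pos.2 hr
  have hx : (3 : ℝ) ≤ d / r := by
    rw [le_div_iff₀ hr']
    exact_mod_cast hrd
  obtain hz | hz := lt_or_ge z (2 * r)
  · have ht : (z : ℝ) / r / 8 ≤ 1 := by
      rw [div_div, div_le_one₀ (by positivity)]
      exact_mod_cast (by omega : z ≤ r * 8)
    refine hasModel_top_of_le_degree hk fun v => le_trans ?_ (hd v)
    have : (24 : ℝ) * k ^ 2 ≤ d := calc
      (24 : ℝ) * k ^ 2 ≤ 72 * k ^ 2 := by gcongr; norm_num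
      _ ≤ ((d : ℝ) / r) ^ (1 : ℝ) :=
        hkx.trans (Real.rpow_le_rpow_of_exponent_le (by linarith) ht)
      _ ≤ d := by
        rw [Real.rpow_one]
        exact div_le_self d.cast_nonneg (Nat.one_le_cast.2 hr)
    exact_mod_cast this
  · obtain ⟨R, hRz, hzR⟩ := exists_radius hr hz
    have ht : (z : ℝ) / r ≤ 4 * R + 6 := by
      rw [div_le_iff₀ hr']
      exact_mod_cast hzR
    refine hasModel_top_of_sq_le_mul_pow hr (by omega) hRz hΓ hd hk ?_
    linarith [rpow_div_eight_le hx ht]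

lemma exists_nat_ge_and_sq_le_pow (y : ℝ) :
    ∃ k : ℕ, 0 < k ∧ y ≤ k ∧ (k = 2 ∨ 72 * (k : ℝ) ^ 2 ≤ y ^ 10) := by
  obtain hy | hy := le_or_gt y 2
  · exact ⟨2, two_pos, hy, .inl rfl⟩
  have hy₀ : 0 < y := two_pos.trans hy
  have ceil_le : (⌈y⌉₊ : ℝ) ≤ 3 / 2 * y := by linarith [Nat.ceil_lt_add_one hy₀.le]
  refine ⟨⌈y⌉₊, Nat.ceil_pos.2 hy₀, Nat.le_ceil y, .inr ?_⟩
  calc 72 * (⌈y⌉₊ : ℝ) ^ 2 ≤ 72 * (3 / 2 * y) ^ 2 := by gcongr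
    _ ≤ 2 ^ 8 * y ^ 2 := by nlinarith [sq_nonneg y]
    _ ≤ y ^ 8 * y ^ 2 := by gcongr
    _ = y ^ 10 := by ring

end CliqueMinors

section MinDegree

variable {α β : Type*} {G : Graph α β} {d : ℕ}

lemma le_ncard_neighborSet_of_le_minDegree [G.Loopless] (hd : d ≤ minDegree G) (v : V(G)) :
    d ≤ (G.toSimpleGraph.neighborSet v).ncard := by
  have adj_eq_image : {y | G.Adj v y} = Subtype.val '' G.toSimpleGraph.neighborSet v := by
    ext y
    refine ⟨fun h => ⟨⟨y, h.right_mem⟩, (Graph.toSimpleGraph_adj_iff _ _).2 h, rfl⟩, ?_⟩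
    rintro ⟨y, h, rfl⟩
    exact (Graph.toSimpleGraph_adj_iff _ _).1 h
  calc d ≤ degree G v := hd.trans (Nat.sInf_le (Set.mem_image_of_mem _ v.2))
    _ = (G.toSimpleGraph.neighborSet v).ncard := by
      rw [degree, adj_eq_image, Set.ncard_image_of_injective _ Subtype.val_injective]

lemma vertexSet_nonempty_of_minDegree_pos (h : 0 < minDegree G) : V(G).Nonempty := by
  by_contra! hV
  rw [minDegree, hV, Set.image_empty, Nat.sInf_empty] at h
  exact h.false

end MinDegree

lemma one_le_sqrt_mul_logb {r d z : ℕ} (hr : 0 < r) (hd : 2 ≤ d) (hz : r ≤ z) :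
    1 ≤ √((z : ℝ) / r * Real.logb 2 d) := by
  have hzr : 1 ≤ (z : ℝ) / r := (one_le_div₀ (Nat.cast_pos.2 hr)).2 (Nat.cast_le.2 hz)
  have hlog : 1 ≤ Real.logb 2 d := by
    rw [Real.le_logb_iff_rpow_le one_lt_two (Nat.cast_pos.2 (two_pos.trans_le hd)), Real.rpow_one]
    exact_mod_cast hd
  exact Real.one_le_sqrt.2 (one_le_mul_of_one_le_of_one_le hzr hlog)

end ThetaGirth

open ThetaGirth in
theorem theorem1_general {α β : Type*} {G : Graph α β} [G.Loopless] {r d z : ℕ}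
    (hV : V(G).Finite) (hE : E(G).Finite) (hr : 0 < r) (hrd : 3 * r ≤ d)
    (hd : d ≤ minDegree G) (hz : (z : ℕ∞) ≤ girth (theta r) G) :
    ∃ k : ℕ, ((d : ℝ) / r) ^ (1 / 80 * ((z : ℝ) / r)) ≤ k ∧ IsMinor (clique k) G := by
  have hdeg := le_ncard_neighborSet_of_le_minDegree hd
  have : Finite V(G) := hV
  have : Nonempty V(G) := (vertexSet_nonempty_of_minDegree_pos (by omega)).to_subtype
  obtain ⟨k, hk, hyk, rfl | hky⟩ :=
    exists_nat_ge_and_sq_le_pow (((d : ℝ) / r) ^ (1 / 80 * ((z : ℝ) / r)))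
  · refine ⟨2, hyk, (hasModel_top_fin_two fun hbot => ?_).isMinor hV hE⟩
    obtain ⟨v⟩ := ‹Nonempty V(G)›
    have := hdeg v
    simp only [hbot, SimpleGraph.neighborSet_bot, Set.ncard_empty] at this
    omega
  · refine ⟨k, hyk, (hasModel_top_of_sq_le_rpow hr hrd
      ((thetaSparse_toSimpleGraph hV hE hr).mono hz) hdeg hk ?_).isMinor hV hE⟩
    rwa [← Real.rpow_mul_natCast (by positivity), show
      1 / 80 * ((z : ℝ) / r) * (10 : ℕ) = (z : ℝ) / r / 8 by push_cast; ring] at hky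

theorem theorem1 :
    ∃ c : ℝ, 0 < c ∧
      ∀ (r d z : ℕ), 2 ≤ r → 3 * r ≤ d → 2 * r ≤ z →
        ∀ (α : Type*) (β : Type*) (G : Graph α β),
          V(G).Finite → E(G).Finite → G.Loopless →
          ThetaGirth.minDegree G = d →
          (z : ℕ∞) ≤ ThetaGirth.girth (ThetaGirth.theta r) G →
          ∃ k : ℕ,
            ((d : ℝ) / r) ^ (c * ((z : ℝ) / r)) / √(((z : ℝ) / r) * Real.logb 2 d) ≤ (k : ℝ) ∧
            ThetaGirth.IsMinor (ThetaGirth.clique k) G := by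
  refine ⟨1 / 80, by norm_num, fun r d z hr hrd hz α β G hV hE hG hd hgirth => ?_⟩
  obtain ⟨k, hk, hminor⟩ := theorem1_general hV hE (by omega) hrd hd.ge hgirth
  exact ⟨k, (div_le_self (by positivity) (ThetaGirth.one_le_sqrt_mul_logb (by omega) (by omega)
    (by omega))).trans hk, hminor⟩
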